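/- A rectilinear (straight-line) drawing $\mathcal D$ of a graph $G$ represents the vertices of $G$ by distinct points of the plane, no three of them collinear, and every edge by the line segment joining its endpoints, in such a way that no three edges share an interior point. A crossing of $\mathcal D$ is a point that is an interior point of two distinct edges, and $e_k(\mathcal D)$ denotes the number of edges that are involved in exactly $k$ crossings. Let $\overline{\min}\ e_k(G)$ be the minimum of $e_k(\mathcal D)$ over all rectilinear drawings $\mathcal D$ of $G$. **Theorem.** There exists a positive integer $N$ such that for every integer $k\ge 1$ and every integer $n\ge N$, $\overline{\min}\ e_k(K_n)=0$; that is, some rectilinear drawing of the complete graph $K_n$ has no edge that is involved in exactly $k$ crossings. -/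

import Mathlib

/-- A rectilinear (straight-line) drawing of a graph `G` in the Euclidean plane. The vertices are
distinct points in general position (no three on a line) and every edge is the segment joining
its endpoints. General position already forces that an edge passes through no vertex other than
its endpoints, that two edges share at most one point, and that edges are never tangent. The last
field says that no three edges share an interior point. -/
structure RectilinearDrawing {V : Type*} (G : SimpleGraph V) where
  /-- The position of each vertex. -/
  pos : V → EuclideanSpace ℝ (Fin 2)
  pos_injective : Function.Injective pos
  general_position : ∀ u v w : V, u ≠ v → u ≠ w → v ≠ w →
    ¬ Collinear ℝ {pos u, pos v, pos w}
  no_three_concurrent : ∀ e ∈ G.edgeSet, ∀ f ∈ G.edgeSet, ∀ g ∈ G.edgeSet,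
    e ≠ f → e ≠ g → f ≠ g →
    ∀ x : EuclideanSpace ℝ (Fin 2),
      ¬ (x ∈ Sym2.lift ⟨fun u v => openSegment ℝ (pos u) (pos v),
            fun u v => openSegment_symm ℝ (pos u) (pos v)⟩ e ∧
         x ∈ Sym2.lift ⟨fun u v => openSegment ℝ (pos u) (pos v),
            fun u v => openSegment_symm ℝ (pos u) (pos v)⟩ f ∧
         x ∈ Sym2.lift ⟨fun u v => openSegment ℝ (pos u) (pos v),
            fun u v => openSegment_symm ℝ (pos u) (pos v)⟩ g)

namespace RectilinearDrawing

/-- The set of interior points of the segment that represents the pair `e` of vertices. -/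
def edgeInterior {V : Type*} {G : SimpleGraph V} (D : RectilinearDrawing G) (e : Sym2 V) :
    Set (EuclideanSpace ℝ (Fin 2)) :=
  Sym2.lift ⟨fun u v => openSegment ℝ (D.pos u) (D.pos v),
    fun u v => openSegment_symm ℝ (D.pos u) (D.pos v)⟩ e

/-- The crossings in which the edge `e` is involved: the interior points of `e` that are also
interior points of another edge of the drawing. -/
def crossingsOn {V : Type*} {G : SimpleGraph V} (D : RectilinearDrawing G) (e : Sym2 V) :
    Set (EuclideanSpace ℝ (Fin 2)) :=
  {x | x ∈ D.edgeInterior e ∧ ∃ f ∈ G.edgeSet, f ≠ e ∧ x ∈ D.edgeInterior f}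

/-- The `k`-crossing set `E_k(D)`: the edges of `G` that are part of exactly `k` crossings. -/
def crossingSet {V : Type*} {G : SimpleGraph V} (D : RectilinearDrawing G) (k : ℕ) :
    Set (Sym2 V) :=
  {e | e ∈ G.edgeSet ∧ (D.crossingsOn e).encard = k}

/-- The `k`-crossing index `e_k(D) = |E_k(D)|`; for a graph with finitely many vertices the
set `E_k(D)` is finite. -/
noncomputable def crossingIndex {V : Type*} {G : SimpleGraph V} (D : RectilinearDrawing G)
    (k : ℕ) : ℕ :=
  (D.crossingSet k).ncard

end RectilinearDrawing

/-! Crossing counts depend only on the orientations of the triples, as long as no three edges meet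
in an interior point. Orientations survive small perturbations, so a configuration in general
position can be moved to a genuine drawing (`exists_drawing_sameOrientation`), and only order types
matter.

Take points on a convex curve, cut at the multiples of `p` into chains with shared end points, and
bend each chain the opposite way. For `p = 1` the position is convex and the crossing numbers are
the products `a * b` with `a + b = n - 2`. In general an edge between different chains loses two
small corrections, one for the chain at each end (`card_crossingPairs`), and an edge inside a chain
has few crossings (`card_crossingPairs_le`).

The chain length is chosen according to `k`. If `4 * k > (n - 3) ^ 2`, two chains of about equal
size keep every crossing number below `k`. If `k` is not a convex-position product, `p = 1` works.
Otherwise `k = a * b` with `b - a` at least of order `√(2 * n)`. Then `p` is a prime with `p ^ 4 ≤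
n` dividing none of `a`, `b`, `a + 1`, `b + 1`. The corrections are too small to bring another
product down to `k`, so both must vanish; this puts the ends of the edge at chain ends, and `p`
would divide one of the four numbers. -/

/-! ### Signed areas and intersections of segments -/

/-- Twice the signed area of the triangle `abc`. -/
def signedArea (a b c : EuclideanSpace ℝ (Fin 2)) : ℝ :=
  (b 0 - a 0) * (c 1 - a 1) - (b 1 - a 1) * (c 0 - a 0)

theorem signedArea_rotate (a b c : EuclideanSpace ℝ (Fin 2)) :
    signedArea b c a = signedArea a b c := by
  simp only [signedArea]; ring

theorem signedArea_swap (a b c : EuclideanSpace ℝ (Fin 2)) :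
    signedArea b a c = -signedArea a b c := by
  simp only [signedArea]; ring

theorem signedArea_swap_right (a b c : EuclideanSpace ℝ (Fin 2)) :
    signedArea a c b = -signedArea a b c := by
  simp only [signedArea]; ring

theorem Collinear.signedArea_eq_zero {a b c : EuclideanSpace ℝ (Fin 2)}
    (h : Collinear ℝ {a, b, c}) : signedArea a b c = 0 := by
  obtain ⟨v, hv⟩ := (collinear_iff_of_mem (p₀ := a) (by simp)).1 h
  obtain ⟨r, hr⟩ := hv b (by simp)
  obtain ⟨s, hs⟩ := hv c (by simp)
  simp [signedArea, hr, hs]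
  ring

theorem exists_coords_of_mem_openSegment {a b x : EuclideanSpace ℝ (Fin 2)}
    (hx : x ∈ openSegment ℝ a b) :
    ∃ t : ℝ, 0 < t ∧ t < 1 ∧ ∀ i, x i = (1 - t) * a i + t * b i := by
  obtain ⟨s, t, hs, ht, hst, rfl⟩ := hx
  obtain rfl : s = 1 - t := by linarith
  exact ⟨t, ht, by linarith, fun i => by simp⟩

theorem mem_openSegment_of_coords {a b x : EuclideanSpace ℝ (Fin 2)} {t : ℝ} (h0 : 0 < t)
    (h1 : t < 1) (hx : ∀ i, x i = (1 - t) * a i + t * b i) : x ∈ openSegment ℝ a b :=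
  ⟨1 - t, t, by linarith, h0, by ring, by ext i; simp [hx]⟩

theorem signedArea_eq_zero_of_mem_openSegment {a b x : EuclideanSpace ℝ (Fin 2)}
    (hx : x ∈ openSegment ℝ a b) : signedArea a b x = 0 := by
  obtain ⟨t, -, -, h⟩ := exists_coords_of_mem_openSegment hx
  simp only [signedArea, h]; ring

theorem signedArea_eq_zero_of_mem_openSegment_common {a b c x : EuclideanSpace ℝ (Fin 2)}
    (hb : x ∈ openSegment ℝ a b) (hc : x ∈ openSegment ℝ a c) : signedArea a b c = 0 := by
  obtain ⟨t, ht, -, h⟩ := exists_coords_of_mem_openSegment hb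
  obtain ⟨s, -, -, h'⟩ := exists_coords_of_mem_openSegment hc
  have e0 : t * (b 0 - a 0) = s * (c 0 - a 0) := by linarith [h 0, h' 0]
  have e1 : t * (b 1 - a 1) = s * (c 1 - a 1) := by linarith [h 1, h' 1]
  have : t * signedArea a b c = 0 := by
    simp only [signedArea]
    linear_combination (c 1 - a 1) * e0 - (c 0 - a 0) * e1
  exact (mul_eq_zero.1 this).resolve_left ht.ne'

theorem signedArea_mul_neg_of_mem_openSegment {a b c d x : EuclideanSpace ℝ (Fin 2)}
    (hab : x ∈ openSegment ℝ a b) (hcd : x ∈ openSegment ℝ c d) (h : signedArea a b c ≠ 0) :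
    signedArea a b c * signedArea a b d < 0 := by
  obtain ⟨s, hs, hs', hx⟩ := exists_coords_of_mem_openSegment hcd
  have key : (1 - s) * signedArea a b c + s * signedArea a b d = 0 := by
    rw [← signedArea_eq_zero_of_mem_openSegment hab]
    simp only [signedArea, hx]; ring
  have : s * (signedArea a b c * signedArea a b d) = -(1 - s) * signedArea a b c ^ 2 := by
    linear_combination signedArea a b c * key
  have h2 : 0 < signedArea a b c ^ 2 := by positivity
  by_contra! h3
  nlinarith [mul_nonneg hs.le h3, mul_pos (sub_pos.2 hs') h2]

theorem exists_mem_openSegment_of_signedArea_mul_neg {a b c d : EuclideanSpace ℝ (Fin 2)}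
    (hab : signedArea a b c * signedArea a b d < 0)
    (hcd : signedArea c d a * signedArea c d b < 0) :
    ∃ x, x ∈ openSegment ℝ a b ∧ x ∈ openSegment ℝ c d := by
  have aux : ∀ p q : ℝ, p * q < 0 → p - q ≠ 0 ∧ 0 < p / (p - q) ∧ p / (p - q) < 1 := by
    intro p q h
    rcases mul_neg_iff.1 h with ⟨hp, hq⟩ | ⟨hp, hq⟩
    · have : 0 < p - q := by linarith
      exact ⟨this.ne', by positivity, (div_lt_one this).2 (by linarith)⟩
    · have : p - q < 0 := by linarith
      exact ⟨this.ne, div_pos_of_neg_of_neg hp this, (div_lt_one_of_neg this).2 (by linarith)⟩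
  obtain ⟨h1, h2, h3⟩ := aux _ _ hab
  obtain ⟨h4, h5, h6⟩ := aux _ _ hcd
  -- The signed area is affine along a segment; `t` and `s` are where it vanishes, and both
  -- parameters give the same point.
  set t := signedArea c d a / (signedArea c d a - signedArea c d b) with ht
  set s := signedArea a b c / (signedArea a b c - signedArea a b d) with hs
  refine ⟨!₂[(1 - t) * a 0 + t * b 0, (1 - t) * a 1 + t * b 1],
    mem_openSegment_of_coords h5 h6 ?_, mem_openSegment_of_coords h2 h3 ?_⟩
  · intro i; fin_cases i <;> simp
  · have hst : signedArea c d a - signedArea c d b =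
        -(signedArea a b c - signedArea a b d) := by
      simp only [signedArea]; ring
    rw [hst, div_neg] at ht
    have key : ∀ i, (1 - t) * a i + t * b i = (1 - s) * c i + s * d i := by
      intro i
      rw [ht, hs]
      field_simp
      fin_cases i <;> simp only [signedArea, Fin.zero_eta, Fin.mk_one] <;> ring
    intro i
    rw [← key]
    fin_cases i <;> simp

theorem subsingleton_openSegment_inter {a b c d : EuclideanSpace ℝ (Fin 2)}
    (h : signedArea a b c ≠ 0) : (openSegment ℝ a b ∩ openSegment ℝ c d).Subsingleton := by
  rintro x ⟨hx, hx'⟩ y ⟨hy, hy'⟩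
  have hne : signedArea a b c - signedArea a b d ≠ 0 := by
    have := signedArea_mul_neg_of_mem_openSegment hx hx' h
    intro h0
    rw [sub_eq_zero.1 h0] at this
    nlinarith [sq_nonneg (signedArea a b d)]
  obtain ⟨s, -, -, hs⟩ := exists_coords_of_mem_openSegment hx'
  obtain ⟨t, -, -, ht⟩ := exists_coords_of_mem_openSegment hy'
  have h1 := signedArea_eq_zero_of_mem_openSegment hx
  have h2 := signedArea_eq_zero_of_mem_openSegment hy
  have : (s - t) * (signedArea a b c - signedArea a b d) = 0 := by
    simp only [signedArea, hs, ht] at h1 h2 ⊢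
    linear_combination h2 - h1
  obtain rfl : s = t := sub_eq_zero.1 ((mul_eq_zero.1 this).resolve_right hne)
  ext i
  rw [hs, ht]

theorem continuous_signedArea {X : Type*} [TopologicalSpace X]
    {f g h : X → EuclideanSpace ℝ (Fin 2)} (hf : Continuous f) (hg : Continuous g)
    (hh : Continuous h) : Continuous fun x => signedArea (f x) (g x) (h x) := by
  unfold signedArea
  fun_prop

/-! ### Perturbation to a drawing without triple crossings -/

theorem exists_mem_signedArea_ne_zero {U : Set (EuclideanSpace ℝ (Fin 2))} (hU : IsOpen U)
    (hne : U.Nonempty) {a b : EuclideanSpace ℝ (Fin 2)} (hab : a ≠ b) :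
    ∃ q ∈ U, signedArea a b q ≠ 0 := by
  obtain ⟨q, hq⟩ := hne
  by_contra! hall
  -- Moving `q` perpendicularly to `ab` changes the area by `t * |b - a| ^ 2`.
  let f : ℝ → EuclideanSpace ℝ (Fin 2) := fun t => q + t • !₂[-(b 1 - a 1), b 0 - a 0]
  have hf : Continuous f := by fun_prop
  have hev : ∀ᶠ t in nhdsWithin (0 : ℝ) {0}ᶜ, f t ∈ U :=
    nhdsWithin_le_nhds (hf.continuousAt.eventually (hU.mem_nhds (by simpa [f] using hq)))
  obtain ⟨t, htU, ht0⟩ := (hev.and self_mem_nhdsWithin).exists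
  have h0 := hall q hq
  have h1 := hall _ htU
  have h2 : t * ((b 0 - a 0) ^ 2 + (b 1 - a 1) ^ 2) = 0 := by
    simp [signedArea, f] at h0 h1
    linear_combination h1 - h0
  have h3 := (mul_eq_zero.1 h2).resolve_left ht0
  apply hab
  ext i
  fin_cases i
  · simp; nlinarith [sq_nonneg (b 1 - a 1), sq_nonneg (b 0 - a 0)]
  · simp; nlinarith [sq_nonneg (b 1 - a 1), sq_nonneg (b 0 - a 0)]

theorem exists_mem_forall_signedArea_ne_zero {U : Set (EuclideanSpace ℝ (Fin 2))}
    (hU : IsOpen U) (hne : U.Nonempty)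
    {T : Set (EuclideanSpace ℝ (Fin 2) × EuclideanSpace ℝ (Fin 2))} (hT : T.Finite)
    (hT' : ∀ t ∈ T, t.1 ≠ t.2) : ∃ q ∈ U, ∀ t ∈ T, signedArea t.1 t.2 q ≠ 0 := by
  induction T, hT using Set.Finite.induction_on generalizing U with
  | empty => obtain ⟨q, hq⟩ := hne; exact ⟨q, hq, by simp⟩
  | @insert t T _ _ ih =>
    obtain ⟨q, hq, hq'⟩ := exists_mem_signedArea_ne_zero hU hne (hT' t (by simp))
    have ho : IsOpen (U ∩ {x | signedArea t.1 t.2 x ≠ 0}) :=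
      hU.inter (isOpen_ne_fun (continuous_signedArea continuous_const continuous_const
        continuous_id) continuous_const)
    obtain ⟨r, hr, hr'⟩ := ih ho ⟨q, hq, hq'⟩ (fun s hs => hT' s (by simp [hs]))
    refine ⟨r, hr.1, fun s hs => ?_⟩
    rcases Set.mem_insert_iff.1 hs with rfl | hs
    · exact hr.2
    · exact hr' s hs

/-- No three segments spanned by six distinct points indexed by `S` share an interior point. -/
def NoConcurrentOn {ι : Type*} (P : ι → EuclideanSpace ℝ (Fin 2)) (S : Finset ι) : Prop :=
  ∀ a ∈ S, ∀ b ∈ S, ∀ c ∈ S, ∀ d ∈ S, ∀ e ∈ S, ∀ f ∈ S, [a, b, c, d, e, f].Nodup →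
    ∀ x, x ∈ openSegment ℝ (P a) (P b) → x ∈ openSegment ℝ (P c) (P d) →
      x ∉ openSegment ℝ (P e) (P f)

/-- All triples of points of the family are non-collinear. -/
def InGeneralPosition {ι : Type*} (P : ι → EuclideanSpace ℝ (Fin 2)) : Prop :=
  ∀ i j k, i ≠ j → i ≠ k → j ≠ k → signedArea (P i) (P j) (P k) ≠ 0

/-- The family has finitely many crossing points, so `q` only has to avoid the finitely many lines
joining a crossing point to a point of the family. -/
theorem InGeneralPosition.exists_mem_noConcurrent {ι : Type*} [Finite ι]
    {P : ι → EuclideanSpace ℝ (Fin 2)} (hP : InGeneralPosition P)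
    {U : Set (EuclideanSpace ℝ (Fin 2))} (hU : IsOpen U) (hne : U.Nonempty) :
    ∃ q ∈ U, ∀ a b c d e, [a, b, c, d, e].Nodup →
        ∀ x, x ∈ openSegment ℝ (P a) (P b) → x ∈ openSegment ℝ (P c) (P d) →
          x ∉ openSegment ℝ (P e) q := by
  have hX : (⋃ i : {i : ι × ι × ι × ι // i.1 ≠ i.2.1 ∧ i.1 ≠ i.2.2.1 ∧ i.2.1 ≠ i.2.2.1},
      openSegment ℝ (P i.1.1) (P i.1.2.1) ∩
        openSegment ℝ (P i.1.2.2.1) (P i.1.2.2.2)).Finite :=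
    Set.finite_iUnion fun i =>
      (subsingleton_openSegment_inter (hP _ _ _ i.2.1 i.2.2.1 i.2.2.2)).finite
  obtain ⟨q, hq, hq'⟩ := exists_mem_forall_signedArea_ne_zero hU hne
    ((hX.prod (Set.finite_range P)).subset (Set.sep_subset _ fun t => t.1 ≠ t.2))
    (fun t ht => ht.2)
  refine ⟨q, hq, fun a b c d e hn x h1 h2 h3 => ?_⟩
  simp only [List.nodup_cons, List.mem_cons, not_or, List.not_mem_nil] at hn
  refine hq' (x, P e) ⟨⟨Set.mem_iUnion.2
    ⟨⟨(a, b, c, d), hn.1.1, hn.1.2.1, hn.2.1.1⟩, h1, h2⟩, e, rfl⟩, ?_⟩ ?_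
  · intro hx
    exact hP a b e hn.1.1 hn.1.2.2.2.1 hn.2.1.2.2.1
      (signedArea_eq_zero_of_mem_openSegment ((show x = P e from hx) ▸ h1))
  · rw [← signedArea_rotate, signedArea_eq_zero_of_mem_openSegment h3]

/-- The points are moved one at a time. Moving point `l` affects only segments ending at `l`, so
concurrences already removed within `S` do not return; openness of `V` leaves room for each move. -/
theorem exists_mem_noConcurrentOn {ι : Type*} [Finite ι]
    {V : Set (ι → EuclideanSpace ℝ (Fin 2))} (hV : IsOpen V) (hne : V.Nonempty)
    (hgen : ∀ P ∈ V, InGeneralPosition P) (S : Finset ι) : ∃ P ∈ V, NoConcurrentOn P S := by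
  classical
  induction S using Finset.induction_on with
  | empty => obtain ⟨P, hP⟩ := hne; exact ⟨P, hP, by simp [NoConcurrentOn]⟩
  | insert l S hl ih =>
    obtain ⟨P, hPV, hP⟩ := ih
    obtain ⟨q, hq, hnew⟩ := (hgen P hPV).exists_mem_noConcurrent
      (U := {q | Function.update P l q ∈ V})
      (hV.preimage (continuous_const.update l continuous_id)) ⟨P l, by simpa using hPV⟩
    refine ⟨Function.update P l q, hq, fun a ha b hb c hc d hd e he f hf hn x h1 h2 h3 => ?_⟩
    have hne : ∀ i, i ≠ l → Function.update P l q i = P i := fun i hi =>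
      Function.update_of_ne hi _ _
    have hl' : Function.update P l q l = q := Function.update_self _ _ _
    have hS : ∀ i ∈ insert l S, i ≠ l → i ∈ S := fun i hi hil =>
      (Finset.mem_insert.1 hi).resolve_left hil
    simp only [List.nodup_cons, List.mem_cons, not_or, List.not_mem_nil, not_false_eq_true,
      and_true, List.nodup_nil] at hn
    simp only [← ne_eq] at hn
    obtain ⟨⟨hab, hac, had, hae, haf⟩, ⟨hbc, hbd, hbe, hbf⟩, ⟨hcd, hce, hcf⟩, ⟨hde, hdf⟩,
      hef⟩ := hn
    by_cases hal : a = l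
    · subst hal
      rw [hl', openSegment_symm, hne b hab.symm] at h1
      rw [hne c hac.symm, hne d had.symm] at h2
      rw [hne e hae.symm, hne f haf.symm] at h3
      exact hnew c d e f b (by grind) x h2 h3 h1
    by_cases hbl : b = l
    · subst hbl
      rw [hl', hne a hal] at h1
      rw [hne c hbc.symm, hne d hbd.symm] at h2
      rw [hne e hbe.symm, hne f hbf.symm] at h3
      exact hnew c d e f a (by grind) x h2 h3 h1
    rw [hne a hal, hne b hbl] at h1
    by_cases hcl : c = l
    · subst hcl
      rw [hl', openSegment_symm, hne d hcd.symm] at h2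
      rw [hne e hce.symm, hne f hcf.symm] at h3
      exact hnew a b e f d (by grind) x h1 h3 h2
    by_cases hdl : d = l
    · subst hdl
      rw [hl', hne c hcl] at h2
      rw [hne e hde.symm, hne f hdf.symm] at h3
      exact hnew a b e f c (by grind) x h1 h3 h2
    rw [hne c hcl, hne d hdl] at h2
    by_cases hel : e = l
    · subst hel
      rw [hl', openSegment_symm, hne f hef.symm] at h3
      exact hnew a b c d f (by grind) x h1 h2 h3
    by_cases hfl : f = l
    · subst hfl
      rw [hl', hne e hel] at h3
      exact hnew a b c d e (by grind) x h1 h2 h3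
    rw [hne e hel, hne f hfl] at h3
    exact hP a (hS a ha hal) b (hS b hb hbl) c (hS c hc hcl) d (hS d hd hdl) e (hS e he hel)
      f (hS f hf hfl) (by grind) x h1 h2 h3

theorem isOpen_setOf_sameOrientation {ι : Type*} [Finite ι]
    (P : ι → EuclideanSpace ℝ (Fin 2)) :
    IsOpen {Q : ι → EuclideanSpace ℝ (Fin 2) | ∀ i j k, i ≠ j → i ≠ k → j ≠ k →
      0 < signedArea (P i) (P j) (P k) * signedArea (Q i) (Q j) (Q k)} := by
  simp only [Set.ofPred_forall]
  refine isOpen_iInter_of_finite fun i => isOpen_iInter_of_finite fun j =>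
    isOpen_iInter_of_finite fun k => isOpen_iInter_of_finite fun _ =>
    isOpen_iInter_of_finite fun _ => isOpen_iInter_of_finite fun _ =>
    isOpen_lt continuous_const (continuous_const.mul
      (continuous_signedArea (continuous_apply i) (continuous_apply j) (continuous_apply k)))

theorem nodup_of_mem_openSegment {ι : Type*} {P : ι → EuclideanSpace ℝ (Fin 2)}
    (hP : InGeneralPosition P) {a b c d : ι} (hab : a ≠ b) (hcd : c ≠ d)
    (hne : s(a, b) ≠ s(c, d)) {x : EuclideanSpace ℝ (Fin 2)}
    (h1 : x ∈ openSegment ℝ (P a) (P b)) (h2 : x ∈ openSegment ℝ (P c) (P d)) :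
    a ≠ c ∧ a ≠ d ∧ b ≠ c ∧ b ≠ d := by
  have key : ∀ a b c : ι, a ≠ b → a ≠ c → s(a, b) ≠ s(a, c) →
      x ∈ openSegment ℝ (P a) (P b) → x ∉ openSegment ℝ (P a) (P c) := by
    intro a b c hab hac hne h1 h2
    have hbc : b ≠ c := by rintro rfl; exact hne rfl
    exact hP a b c hab hac hbc (signedArea_eq_zero_of_mem_openSegment_common h1 h2)
  have h1' := openSegment_symm ℝ (P a) (P b) ▸ h1
  have h2' := openSegment_symm ℝ (P c) (P d) ▸ h2
  refine ⟨?_, ?_, ?_, ?_⟩ <;> rintro rfl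
  · exact key a b d hab hcd hne h1 h2
  · exact key a b c hab hcd.symm (by rwa [Sym2.eq_swap (a := a) (b := c)]) h1 h2'
  · exact key b a d hab.symm hcd (by rwa [Sym2.eq_swap (a := b) (b := a)]) h1' h2
  · exact key b a c hab.symm hcd.symm
      (by rwa [Sym2.eq_swap (a := b) (b := a), Sym2.eq_swap (a := b) (b := c)]) h1' h2'

/-- Every order type in general position on at least three points is that of a rectilinear drawing
of the complete graph. -/
theorem exists_drawing_sameOrientation {n : ℕ} (hn : 3 ≤ n)
    {P : Fin n → EuclideanSpace ℝ (Fin 2)} (hP : InGeneralPosition P) :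
    ∃ D : RectilinearDrawing (⊤ : SimpleGraph (Fin n)), ∀ i j k, i ≠ j → i ≠ k → j ≠ k →
      0 < signedArea (P i) (P j) (P k) * signedArea (D.pos i) (D.pos j) (D.pos k) := by
  obtain ⟨Q, hQ, hQ'⟩ := exists_mem_noConcurrentOn (isOpen_setOf_sameOrientation P)
    ⟨P, fun i j k h1 h2 h3 => mul_self_pos.2 (hP i j k h1 h2 h3)⟩
    (fun Q hQ i j k h1 h2 h3 => right_ne_zero_of_mul (hQ i j k h1 h2 h3).ne') Finset.univ
  have hgen : InGeneralPosition Q := fun i j k h1 h2 h3 =>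
    right_ne_zero_of_mul (hQ i j k h1 h2 h3).ne'
  refine ⟨⟨Q, fun i j hij => ?_, fun u v w h1 h2 h3 hc =>
    hgen u v w h1 h2 h3 hc.signedArea_eq_zero, ?_⟩, hQ⟩
  · by_contra hne
    -- Non-collinearity separates two points only with a third one at hand; this uses `3 ≤ n`.
    obtain ⟨k, hk⟩ : ∃ k : Fin n, k ∉ ({i, j} : Finset (Fin n)) := by
      by_contra! h
      have h1 := Finset.card_le_card (fun k _ => h k : Finset.univ ⊆ ({i, j} : Finset (Fin n)))
      have h2 := Finset.card_le_two (a := i) (b := j)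
      simp only [Finset.card_univ, Fintype.card_fin] at h1
      omega
    simp only [Finset.mem_insert, Finset.mem_singleton, not_or] at hk
    refine hgen i j k hne (Ne.symm hk.1) (Ne.symm hk.2) ?_
    simp [signedArea, hij]
  · intro e he f hf g hg hef heg hfg x
    induction e using Sym2.ind with | _ a b
    induction f using Sym2.ind with | _ c d
    induction g using Sym2.ind with | _ e f
    simp only [SimpleGraph.mem_edgeSet, SimpleGraph.top_adj, Sym2.lift_mk] at *
    rintro ⟨h1, h2, h3⟩
    have k1 := nodup_of_mem_openSegment hgen he hf hef h1 h2
    have k2 := nodup_of_mem_openSegment hgen he hg heg h1 h3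
    have k3 := nodup_of_mem_openSegment hgen hf hg hfg h2 h3
    exact hQ' a (by simp) b (by simp) c (by simp) d (by simp) e (by simp) f (by simp)
      (by grind) x h1 h2 h3

/-! ### Crossings read off from orientations -/

/-- Pairs of vertices, on the left and on the right of the directed line `uv`, whose segment
crosses `uv`. -/
def crossingPairs {V : Type*} (P : V → EuclideanSpace ℝ (Fin 2)) (u v : V) : Set (V × V) :=
  {t | 0 < signedArea (P u) (P v) (P t.1) ∧ signedArea (P u) (P v) (P t.2) < 0 ∧
    signedArea (P t.1) (P t.2) (P u) * signedArea (P t.1) (P t.2) (P v) < 0}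

/-- Ordering each pair as (left, right) counts every segment once, and the absence of triple
crossings makes different segments meet `uv` in different points. -/
theorem RectilinearDrawing.encard_crossingsOn {V : Type*}
    (D : RectilinearDrawing (⊤ : SimpleGraph V)) (hD : InGeneralPosition D.pos) {u v : V}
    (huv : u ≠ v) : (D.crossingsOn s(u, v)).encard = (crossingPairs D.pos u v).encard := by
  have hex : ∀ t : V × V, ∃ x, t ∈ crossingPairs D.pos u v →
      x ∈ openSegment ℝ (D.pos u) (D.pos v) ∧ x ∈ openSegment ℝ (D.pos t.1) (D.pos t.2) := by
    intro t
    by_cases ht : t ∈ crossingPairs D.pos u v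
    · obtain ⟨x, hx⟩ := exists_mem_openSegment_of_signedArea_mul_neg
        (mul_neg_of_pos_of_neg ht.1 ht.2.1) ht.2.2
      exact ⟨x, fun _ => hx⟩
    · exact ⟨0, fun h => (ht h).elim⟩
  choose f hf using hex
  have hne : ∀ t ∈ crossingPairs D.pos u v, t.1 ≠ t.2 ∧ s(t.1, t.2) ≠ s(u, v) := by
    rintro ⟨x, y⟩ ⟨h1, h2, -⟩
    refine ⟨fun h => ?_, fun h => ?_⟩
    · exact lt_asymm h1 ((show x = y from h) ▸ h2)
    · rcases Sym2.eq_iff.1 h with ⟨h, -⟩ | ⟨h, -⟩ <;> dsimp only at h <;> subst h <;>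
        simp [signedArea, mul_comm] at h1
  have hinj : Set.InjOn f (crossingPairs D.pos u v) := by
    intro t ht s hs hts
    by_cases hst : s(t.1, t.2) = s(s.1, s.2)
    · rcases Sym2.eq_iff.1 hst with ⟨h1, h2⟩ | ⟨h1, -⟩
      · exact Prod.ext h1 h2
      · exact (lt_asymm (h1 ▸ ht.1) hs.2.1).elim
    · exact (D.no_three_concurrent s(u, v) huv s(t.1, t.2) (hne t ht).1 s(s.1, s.2) (hne s hs).1
        (hne t ht).2.symm (hne s hs).2.symm hst (f t)
        ⟨(hf t ht).1, (hf t ht).2, hts ▸ (hf s hs).2⟩).elim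
  rw [← hinj.encard_image]
  congr 1
  ext z
  constructor
  · rintro ⟨hz, g, hg, hgne, hzg⟩
    induction g using Sym2.ind with | _ x y
    have hxy : x ≠ y := hg
    change z ∈ openSegment ℝ (D.pos u) (D.pos v) at hz
    change z ∈ openSegment ℝ (D.pos x) (D.pos y) at hzg
    obtain ⟨hux, huy, hvx, hvy⟩ := nodup_of_mem_openSegment hD huv hxy hgne.symm hz hzg
    have hsep := signedArea_mul_neg_of_mem_openSegment hz hzg (hD u v x huv hux hvx)
    have hsep' := signedArea_mul_neg_of_mem_openSegment hzg hz (hD x y u hxy hux.symm huy.symm)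
    have fin : ∀ t ∈ crossingPairs D.pos u v, z ∈ openSegment ℝ (D.pos t.1) (D.pos t.2) →
        z ∈ f '' crossingPairs D.pos u v := by
      intro t ht hzt
      have hnt := hne t ht
      obtain ⟨h1, -, h2, -⟩ := nodup_of_mem_openSegment hD huv hnt.1 hnt.2.symm hz hzt
      exact ⟨t, ht, subsingleton_openSegment_inter (hD u v t.1 huv h1 h2) (hf t ht) ⟨hz, hzt⟩⟩
    rcases mul_neg_iff.1 hsep with ⟨h1, h2⟩ | ⟨h1, h2⟩
    · exact fin (x, y) ⟨h1, h2, hsep'⟩ hzg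
    · refine fin (y, x) ⟨h2, h1, ?_⟩ (openSegment_symm ℝ (D.pos x) (D.pos y) ▸ hzg)
      simpa only [signedArea_swap (D.pos x) (D.pos y), neg_mul_neg] using hsep'
  · rintro ⟨t, ht, rfl⟩
    exact ⟨(hf t ht).1, s(t.1, t.2), (hne t ht).1, (hne t ht).2, (hf t ht).2⟩

/-! ### Chain orientations and their crossing numbers -/

/-- Cut the sequence of points into chains at the multiples of `p`, consecutive chains sharing
their end point. A triple is oriented clockwise if it lies in one chain, and counterclockwise
otherwise. -/
def HasChainOrientation {n : ℕ} (p : ℕ) (P : Fin n → EuclideanSpace ℝ (Fin 2)) : Prop :=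
  ∀ i j k : Fin n, i < j → j < k →
    (((i : ℕ) / p + 1) * p < k → 0 < signedArea (P i) (P j) (P k)) ∧
    ((k : ℕ) ≤ ((i : ℕ) / p + 1) * p → signedArea (P i) (P j) (P k) < 0)

namespace HasChainOrientation

variable {n p : ℕ} {P : Fin n → EuclideanSpace ℝ (Fin 2)} {u v : Fin n}

theorem inGeneralPosition (h : HasChainOrientation p P) : InGeneralPosition P := by
  have key : ∀ i j k : Fin n, i < j → j < k → signedArea (P i) (P j) (P k) ≠ 0 := by
    intro i j k hij hjk
    rcases lt_or_ge (((i : ℕ) / p + 1) * p) k with hk | hk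
    · exact ((h i j k hij hjk).1 hk).ne'
    · exact ((h i j k hij hjk).2 hk).ne
  intro i j k hij hik hjk
  rcases lt_or_gt_of_ne hij with h1 | h1 <;> rcases lt_or_gt_of_ne hik with h2 | h2 <;>
    rcases lt_or_gt_of_ne hjk with h3 | h3
  · exact key _ _ _ h1 h3
  · rw [signedArea_swap_right, neg_ne_zero]; exact key _ _ _ h2 h3
  · exact (lt_asymm (h1.trans h3) h2).elim
  · rw [signedArea_rotate]; exact key _ _ _ h2 h1
  · rw [signedArea_swap, neg_ne_zero]; exact key _ _ _ h1 h2
  · exact (lt_asymm (h2.trans h3) h1).elim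
  · rw [← signedArea_rotate]; exact key _ _ _ h3 h2
  · rw [← signedArea_rotate, signedArea_swap, neg_ne_zero]; exact key _ _ _ h3 h1

theorem congr (h : HasChainOrientation p P) {Q : Fin n → EuclideanSpace ℝ (Fin 2)}
    (hQ : ∀ i j k, i ≠ j → i ≠ k → j ≠ k →
      0 < signedArea (P i) (P j) (P k) * signedArea (Q i) (Q j) (Q k)) :
    HasChainOrientation p Q := by
  intro i j k hij hjk
  have hpos := hQ i j k hij.ne (hij.trans hjk).ne hjk.ne
  exact ⟨fun hk => (pos_iff_pos_of_mul_pos hpos).1 ((h i j k hij hjk).1 hk),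
    fun hk => (neg_iff_neg_of_mul_pos hpos).1 ((h i j k hij hjk).2 hk)⟩

end HasChainOrientation

theorem Nat.lt_div_add_one_mul (a : ℕ) {p : ℕ} (hp : 0 < p) : a < (a / p + 1) * p := by
  rw [Nat.add_mul, Nat.one_mul]; exact Nat.lt_div_mul_add hp

theorem Nat.div_add_one_mul_mono {a b : ℕ} (p : ℕ) (h : a ≤ b) :
    (a / p + 1) * p ≤ (b / p + 1) * p :=
  Nat.mul_le_mul_right _ (Nat.succ_le_succ (Nat.div_le_div_right h))

theorem Nat.div_eq_div_of_lt_div_add_one_mul {a b p : ℕ} (hab : a ≤ b)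
    (hb : b < (a / p + 1) * p) : b / p = a / p :=
  Nat.div_eq_of_lt_le ((Nat.div_mul_le_self a p).trans hab) hb

theorem Nat.div_add_one_mul_eq_of_le_of_lt {a b p : ℕ} (h : b / p * p ≤ a) (hab : a < b) :
    (a / p + 1) * p = (b / p + 1) * p := by
  rcases p.eq_zero_or_pos with rfl | hp
  · simp
  · rw [Nat.div_eq_of_lt_le h (hab.trans (Nat.lt_div_add_one_mul b hp))]

theorem Nat.div_add_one_mul_le_of_lt_div_mul {a b p : ℕ} (h : a < b / p * p) :
    (a / p + 1) * p ≤ b / p * p := by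
  rcases p.eq_zero_or_pos with rfl | hp
  · simp
  · exact Nat.mul_le_mul_right _ ((Nat.div_lt_iff_lt_mul hp).2 h)

namespace HasChainOrientation

variable {n p : ℕ} {P : Fin n → EuclideanSpace ℝ (Fin 2)} {u v : Fin n}

theorem signedArea_pos_iff (h : HasChainOrientation p P)
    (huv : ((u : ℕ) / p + 1) * p < v) (hlt : u < v) (x : Fin n) :
    (0 < signedArea (P u) (P v) (P x) ↔ x < u ∨ v < x) ∧
      (signedArea (P u) (P v) (P x) < 0 ↔ u < x ∧ x < v) := by
  have hout : x < u ∨ v < x → 0 < signedArea (P u) (P v) (P x) := by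
    rintro (hx | hx)
    · rw [signedArea_rotate]
      exact (h x u v hx hlt).1 ((Nat.div_add_one_mul_mono p hx.le).trans_lt huv)
    · exact (h u v x hlt hx).1 (huv.trans hx)
  have hin : u < x ∧ x < v → signedArea (P u) (P v) (P x) < 0 := by
    rintro ⟨h1, h2⟩
    rw [signedArea_swap_right, neg_lt_zero]
    exact (h u x v h1 h2).1 huv
  have heq : x = u ∨ x = v → signedArea (P u) (P v) (P x) = 0 := by
    rintro (rfl | rfl) <;> simp [signedArea, mul_comm]
  rcases lt_trichotomy x u with h1 | h1 | h1 <;> rcases lt_trichotomy x v with h2 | h2 | h2 <;>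
    grind

/-- One end must lie between `u` and `v` and the other outside. The end of `uv` farther from the
outer point is always to the left of `xy`, so the crossing fails exactly when the nearer end lies in
one chain with `x` and `y`. -/
theorem mem_crossingPairs_iff (h : HasChainOrientation p P)
    (huv : ((u : ℕ) / p + 1) * p < v) (hlt : u < v) (x y : Fin n) :
    (x, y) ∈ crossingPairs P u v ↔ (u < y ∧ y < v) ∧
      ((x < u ∧ ((x : ℕ) / p + 1) * p < y) ∨ (v < x ∧ ((y : ℕ) / p + 1) * p < x)) := by
  simp only [crossingPairs, Set.mem_ofPred_eq, (h.signedArea_pos_iff huv hlt _).1,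
    (h.signedArea_pos_iff huv hlt _).2]
  have iff_pos : ∀ i j k : Fin n, i < j → j < k →
      (0 < signedArea (P i) (P j) (P k) ↔ ((i : ℕ) / p + 1) * p < k) := by
    intro i j k hij hjk
    refine ⟨fun hpos => ?_, (h i j k hij hjk).1⟩
    by_contra! hle
    exact lt_asymm hpos ((h i j k hij hjk).2 hle)
  have hleft : u < y ∧ y < v → x < u →
      (signedArea (P x) (P y) (P u) * signedArea (P x) (P y) (P v) < 0 ↔
        ((x : ℕ) / p + 1) * p < y) := by
    rintro ⟨h1, h2⟩ hx
    rw [← iff_pos x u y hx h1, signedArea_swap_right]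
    have := (h x y v (hx.trans h1) h2).1 ((Nat.div_add_one_mul_mono p hx.le).trans_lt huv)
    rw [neg_mul, neg_lt_zero, mul_pos_iff_of_pos_right this]
  have hright : u < y ∧ y < v → v < x →
      (signedArea (P x) (P y) (P u) * signedArea (P x) (P y) (P v) < 0 ↔
        ((y : ℕ) / p + 1) * p < x) := by
    rintro ⟨h1, h2⟩ hx
    rw [← iff_pos y v x h2 hx, ← signedArea_rotate, signedArea_swap,
      ← signedArea_rotate (P x) (P y) (P v)]
    have := (h u y x h1 (h2.trans hx)).1 (huv.trans hx)
    rw [neg_mul, neg_lt_zero, mul_pos_iff_of_pos_left this]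
  grind

/-- The right-hand side is the count in convex position. The pairs lost are those lying in one chain
around `u` or around `v`; the `min` accounts for a truncated last chain. -/
theorem card_crossingPairs (h : HasChainOrientation p P) (hp : 0 < p)
    (huv : ((u : ℕ) / p + 1) * p < v) :
    (crossingPairs P u v).ncard + (u : ℕ) % p * (p - (u : ℕ) % p) +
        (v : ℕ) % p * (min (((v : ℕ) / p + 1) * p) (n - 1) - v) =
      ((v : ℕ) - u - 1) * (n - 1 - (v - u)) := by
  have hu := Nat.lt_div_add_one_mul u hp
  have hv := Nat.lt_div_add_one_mul v hp
  have hlt : (u : ℕ) < v := hu.trans huv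
  have hvn := v.isLt
  set F : ℕ := ((u : ℕ) / p + 1) * p with hF
  set M : ℕ := min (((v : ℕ) / p + 1) * p) (n - 1) with hM
  let A : Finset (ℕ × ℕ) := (Finset.range u ∪ Finset.Ioo (v : ℕ) n) ×ˢ Finset.Ioo (u : ℕ) v
  let B : Finset (ℕ × ℕ) := Finset.Ico ((u : ℕ) / p * p) u ×ˢ Finset.Ioc (u : ℕ) F
  let C : Finset (ℕ × ℕ) := Finset.Ioc (v : ℕ) M ×ˢ Finset.Ico ((v : ℕ) / p * p) v
  have huv' : (u : ℕ) < (v : ℕ) / p * p := by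
    refine hu.trans_le (Nat.mul_le_mul_right _ ?_)
    rw [Nat.le_div_iff_mul_le hp]
    exact huv.le
  have hiff : ∀ x y : Fin n, (x, y) ∈ crossingPairs P u v ↔
      ((x : ℕ), (y : ℕ)) ∈ A \ (B ∪ C) := by
    intro x y
    have hx := Nat.div_add_one_mul_eq_of_le_of_lt (a := x) (b := u) (p := p)
    have hx' := Nat.div_add_one_mul_le_of_lt_div_mul (a := x) (b := u) (p := p)
    have hy := Nat.div_add_one_mul_eq_of_le_of_lt (a := y) (b := v) (p := p)
    have hy' := Nat.div_add_one_mul_le_of_lt_div_mul (a := y) (b := v) (p := p)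
    have hu' := Nat.div_mul_le_self u p
    have hv' := Nat.div_mul_le_self v p
    have hxn := x.isLt
    rw [h.mem_crossingPairs_iff huv hlt]
    simp only [A, B, C, Finset.mem_union, Finset.mem_product, Finset.mem_Ico, Finset.mem_Ioc,
      Finset.mem_Ioo, Finset.mem_range, Finset.mem_sdiff, Fin.lt_def]
    omega
  have himage : Prod.map Fin.val Fin.val '' crossingPairs P u v =
      ((A \ (B ∪ C) : Finset _) : Set (ℕ × ℕ)) := by
    ext t
    refine ⟨?_, fun ht => ?_⟩
    · rintro ⟨⟨x, y⟩, ht, rfl⟩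
      exact (hiff x y).1 ht
    · have ht' : t.1 < n ∧ t.2 < n := by
        have ht0 := (Finset.mem_sdiff.1 ht).1
        simp only [A, Finset.mem_union, Finset.mem_product, Finset.mem_Ioo,
          Finset.mem_range] at ht0
        omega
      exact ⟨(⟨t.1, ht'.1⟩, ⟨t.2, ht'.2⟩), (hiff _ _).2 ht, rfl⟩
  have hBA : B ∪ C ⊆ A := by
    intro t
    simp only [A, B, C, Finset.mem_union, Finset.mem_product, Finset.mem_Ico, Finset.mem_Ioc,
      Finset.mem_Ioo, Finset.mem_range]
    omega
  have hBC : Disjoint B C := by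
    rw [Finset.disjoint_left]
    intro t
    simp only [B, C, Finset.mem_product, Finset.mem_Ico, Finset.mem_Ioc]
    omega
  have hcard : (crossingPairs P u v).ncard = A.card - (B.card + C.card) := by
    rw [← Finset.card_union_of_disjoint hBC, ← Finset.card_sdiff_of_subset hBA,
      ← Set.ncard_coe_finset, ← himage, Set.ncard_image_of_injective _
        (Fin.val_injective.prodMap Fin.val_injective)]
  have hle : B.card + C.card ≤ A.card := by
    rw [← Finset.card_union_of_disjoint hBC]; exact Finset.card_le_card hBA
  have hAc : A.card = ((v : ℕ) - u - 1) * (n - 1 - (v - u)) := by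
    rw [Finset.card_product, Finset.card_union_of_disjoint, Finset.card_range, Nat.card_Ioo,
      Nat.card_Ioo, mul_comm]
    · congr 1
      omega
    · rw [Finset.disjoint_left]
      intro t
      simp only [Finset.mem_range, Finset.mem_Ioo]
      omega
  have hBc : B.card = (u : ℕ) % p * (p - (u : ℕ) % p) := by
    rw [Finset.card_product, Nat.card_Ico, Nat.card_Ioc]
    have := Nat.div_add_mod' u p
    have e : F = (u : ℕ) / p * p + p := by rw [hF]; ring
    congr 1 <;> omega
  have hCc : C.card = (v : ℕ) % p * (M - v) := by
    rw [Finset.card_product, Nat.card_Ico, Nat.card_Ioc, mul_comm]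
    have := Nat.div_add_mod' v p
    congr 1; omega
  omega

/-- To the right of `uv` lie only points of its own chain outside the interval from `u` to `v`. A
point on the left that is not between `u` and `v` sees both ends on the same side of its segment to
such a point, so it contributes nothing. -/
theorem card_crossingPairs_le (h : HasChainOrientation p P) (hlt : u < v)
    (huv : (v : ℕ) ≤ ((u : ℕ) / p + 1) * p) :
    (crossingPairs P u v).ncard ≤ ((v : ℕ) - u - 1) * (p - (v - u)) := by
  have hmem : ∀ t ∈ crossingPairs P u v, (u < t.1 ∧ t.1 < v) ∧
      (((u : ℕ) / p * p ≤ t.2 ∧ t.2 < u) ∨ (v < t.2 ∧ t.2 ≤ ((u : ℕ) / p + 1) * p)) := by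
    rintro ⟨x, y⟩ ⟨hx, hy, hxy⟩
    dsimp only at hx hy hxy ⊢
    have same : ∀ a b c : Fin n, a < b → b < c → signedArea (P a) (P b) (P c) < 0 →
        (c : ℕ) ≤ ((a : ℕ) / p + 1) * p := by
      intro a b c hab hbc hneg
      by_contra! hc
      exact lt_asymm hneg ((h a b c hab hbc).1 hc)
    have diff : ∀ a b c : Fin n, a < b → b < c → 0 < signedArea (P a) (P b) (P c) →
        ((a : ℕ) / p + 1) * p < c := by
      intro a b c hab hbc hpos
      by_contra! hc
      exact lt_asymm hpos ((h a b c hab hbc).2 hc)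
    have hxu : x ≠ u := by rintro rfl; simp [signedArea] at hx
    have hxv : x ≠ v := by rintro rfl; simp [signedArea, mul_comm] at hx
    have hyu : y ≠ u := by rintro rfl; simp [signedArea] at hy
    have hyv : y ≠ v := by rintro rfl; simp [signedArea, mul_comm] at hy
    have hu0 := Nat.div_mul_le_self u p
    have hy' : ((u : ℕ) / p * p ≤ y ∧ y < u) ∨ (v < y ∧ y ≤ ((u : ℕ) / p + 1) * p) := by
      rcases lt_or_gt_of_ne hyu with h1 | h1
      · left
        refine ⟨?_, h1⟩
        rw [signedArea_rotate] at hy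
        by_contra! hlt'
        have := same y u v h1 hlt hy
        have := Nat.div_add_one_mul_le_of_lt_div_mul hlt'
        omega
      rcases lt_or_gt_of_ne hyv with h2 | h2
      · rw [signedArea_swap_right, neg_lt_zero] at hy
        exact (lt_asymm hy ((h u y v h1 h2).2 huv)).elim
      · exact Or.inr ⟨h2, same u v y hlt h2 hy⟩
    refine ⟨?_, hy'⟩
    by_contra hx'
    refine lt_asymm hxy ?_
    rcases lt_or_gt_of_ne hxu with h1 | h1
    · rw [signedArea_rotate] at hx
      have hd := diff x u v h1 hlt hx
      have hxlt : (x : ℕ) < (u : ℕ) / p * p := by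
        by_contra! hle
        have := Nat.div_add_one_mul_eq_of_le_of_lt hle h1
        omega
      have hd' := Nat.div_add_one_mul_le_of_lt_div_mul hxlt
      rcases hy' with ⟨h3, h4⟩ | ⟨h3, h4⟩
      · have hxy' : x < y := by omega
        exact mul_pos ((h x y u hxy' h4).1 (by omega)) ((h x y v hxy' (h4.trans hlt)).1 hd)
      · rw [signedArea_swap_right, signedArea_swap_right (P x) (P v), neg_mul_neg]
        exact mul_pos ((h x u y h1 (hlt.trans h3)).1 (by omega))
          ((h x v y (h1.trans hlt) h3).1 (by omega))
    · have h2 : v < x := by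
        rcases lt_or_gt_of_ne hxv with h2 | h2
        · exact (hx' ⟨h1, h2⟩).elim
        · exact h2
      have hd := diff u v x hlt h2 hx
      rcases hy' with ⟨h3, h4⟩ | ⟨h3, h4⟩
      · have := Nat.div_add_one_mul_eq_of_le_of_lt h3 h4
        rw [← signedArea_rotate, ← signedArea_rotate (P x) (P y) (P v)]
        exact mul_pos ((h y u x h4 h1).1 (by omega)) ((h y v x (h4.trans hlt) h2).1 (by omega))
      · have hyx : y < x := by omega
        have := Nat.div_eq_div_of_lt_div_add_one_mul hlt.le
          (show (v : ℕ) < ((u : ℕ) / p + 1) * p by omega)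
        rw [← signedArea_rotate, ← signedArea_rotate (P x) (P y) (P v), signedArea_swap,
          signedArea_swap (P v) (P y), neg_mul_neg]
        exact mul_pos ((h u y x (hlt.trans h3) hyx).1 hd) ((h v y x h3 hyx).1 (by rwa [this]))
  have hsub : Prod.map Fin.val Fin.val '' crossingPairs P u v ⊆
      ((Finset.Ioo (u : ℕ) v ×ˢ (Finset.Ico ((u : ℕ) / p * p) u ∪
        Finset.Ioc (v : ℕ) (((u : ℕ) / p + 1) * p)) : Finset (ℕ × ℕ)) : Set (ℕ × ℕ)) := by
    rintro _ ⟨t, ht, rfl⟩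
    simpa [and_or_left] using hmem t ht
  have hc := Set.ncard_le_ncard hsub (Finset.finite_toSet _)
  rw [Set.ncard_image_of_injective _ (Fin.val_injective.prodMap Fin.val_injective),
    Set.ncard_coe_finset, Finset.card_product, Nat.card_Ioo] at hc
  refine hc.trans (Nat.mul_le_mul_left _ ((Finset.card_union_le _ _).trans ?_))
  rw [Nat.card_Ico, Nat.card_Ioc]
  have := Nat.div_mul_le_self u p
  rw [Nat.add_mul, Nat.one_mul] at huv ⊢
  have : (u : ℕ) < v := hlt
  omega

end HasChainOrientation

/-! ### Points realizing the chain orientation -/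

theorem one_le_slope_difference_sum_div {i j k p : ℕ} (hp : 0 < p) (hij : i < j) (hjk : j < k)
    (hk : (i / p + 1) * p < k) :
    1 ≤ ((j : ℤ) - i) * ((∑ t ∈ Finset.range k, t / p : ℕ) - (∑ t ∈ Finset.range j, t / p : ℕ)) -
      ((k : ℤ) - j) *
        ((∑ t ∈ Finset.range j, t / p : ℕ) - (∑ t ∈ Finset.range i, t / p : ℕ)) := by
  have hsum : ∀ a b : ℕ, a ≤ b →
      ((∑ t ∈ Finset.range b, t / p : ℕ) : ℤ) - (∑ t ∈ Finset.range a, t / p : ℕ) =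
        ∑ t ∈ Finset.Ico a b, ((t / p : ℕ) : ℤ) := by
    intro a b hab
    push_cast
    rw [Finset.sum_Ico_eq_sub _ hab]
  -- As a double sum of slope differences all terms are nonnegative, and the term `(i, k - 1)` is at
  -- least `1`.
  have key : ((j : ℤ) - i) * (∑ t ∈ Finset.Ico j k, ((t / p : ℕ) : ℤ)) -
      ((k : ℤ) - j) * (∑ t ∈ Finset.Ico i j, ((t / p : ℕ) : ℤ)) =
      ∑ s ∈ Finset.Ico i j, ∑ t ∈ Finset.Ico j k, (((t / p : ℕ) : ℤ) - ((s / p : ℕ) : ℤ)) := by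
    simp only [Finset.sum_sub_distrib, Finset.sum_const, Nat.card_Ico, nsmul_eq_mul,
      ← Finset.mul_sum, Nat.cast_sub hij.le, Nat.cast_sub hjk.le]
  rw [hsum _ _ hjk.le, hsum _ _ hij.le, key]
  have hnonneg : ∀ s ∈ Finset.Ico i j, ∀ t ∈ Finset.Ico j k,
      (0 : ℤ) ≤ ((t / p : ℕ) : ℤ) - ((s / p : ℕ) : ℤ) := by
    intro s hs t ht
    rw [Finset.mem_Ico] at hs ht
    have := Nat.div_le_div_right (c := p) (hs.2.le.trans ht.1)
    omega
  have hi : i ∈ Finset.Ico i j := Finset.mem_Ico.2 ⟨le_rfl, hij⟩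
  have hk' : k - 1 ∈ Finset.Ico j k := Finset.mem_Ico.2 ⟨by omega, by omega⟩
  have hlast : i / p + 1 ≤ (k - 1) / p := (Nat.le_div_iff_mul_le hp).2 (by omega)
  calc (1 : ℤ) ≤ (((k - 1) / p : ℕ) : ℤ) - ((i / p : ℕ) : ℤ) := by omega
    _ ≤ ∑ t ∈ Finset.Ico j k, (((t / p : ℕ) : ℤ) - ((i / p : ℕ) : ℤ)) :=
      Finset.single_le_sum (f := fun t => ((t / p : ℕ) : ℤ) - ((i / p : ℕ) : ℤ))
        (hnonneg i hi) hk'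
    _ ≤ _ := Finset.single_le_sum
        (f := fun s => ∑ t ∈ Finset.Ico j k, (((t / p : ℕ) : ℤ) - ((s / p : ℕ) : ℤ)))
        (fun s hs => Finset.sum_nonneg (hnonneg s hs)) hi

theorem sum_div_eq_of_le {i j p : ℕ} (hij : i ≤ j) (hj : j ≤ (i / p + 1) * p) :
    ∑ t ∈ Finset.range j, t / p = ∑ t ∈ Finset.range i, t / p + (j - i) * (i / p) := by
  have hconst : ∑ t ∈ Finset.Ico i j, t / p = ∑ t ∈ Finset.Ico i j, i / p := by
    refine Finset.sum_congr rfl fun t ht => ?_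
    rw [Finset.mem_Ico] at ht
    exact Nat.div_eq_div_of_lt_div_add_one_mul ht.1 (ht.2.trans_le hj)
  rw [← Finset.sum_range_add_sum_Ico _ hij, hconst]
  simp

/-- Points on the graph of a convex piecewise linear function with kinks at the multiples of `p`,
each linear piece being bent slightly upwards. -/
noncomputable def chainPoints (n p : ℕ) (i : Fin n) : EuclideanSpace ℝ (Fin 2) :=
  !₂[(i : ℝ), (n : ℝ) ^ 3 * ((∑ t ∈ Finset.range i, t / p : ℕ) : ℝ) - (i : ℝ) ^ 2]

theorem hasChainOrientation_chainPoints (n : ℕ) {p : ℕ} (hp : 0 < p) :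
    HasChainOrientation p (chainPoints n p) := by
  intro i j k hij hjk
  have hij' : (i : ℕ) < j := hij
  have hjk' : (j : ℕ) < k := hjk
  have h1 : (i : ℝ) < j := by exact_mod_cast hij'
  have h2 : (j : ℝ) < k := by exact_mod_cast hjk'
  have h3 : (k : ℝ) < n := by exact_mod_cast k.isLt
  have h0 : (0 : ℝ) ≤ i := by positivity
  set g : ℕ → ℝ := fun m => ((∑ t ∈ Finset.range m, t / p : ℕ) : ℝ) with hg
  have harea : signedArea (chainPoints n p i) (chainPoints n p j) (chainPoints n p k) =
      (n : ℝ) ^ 3 * (((j : ℝ) - i) * (g k - g j) - ((k : ℝ) - j) * (g j - g i)) -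
        ((j : ℝ) - i) * ((k : ℝ) - j) * ((k : ℝ) - i) := by
    simp only [signedArea, chainPoints, hg]
    simp
    ring
  rw [harea]
  refine ⟨fun hk => ?_, fun hk => ?_⟩
  · have hG : (1 : ℝ) ≤ ((j : ℝ) - i) * (g k - g j) - ((k : ℝ) - j) * (g j - g i) := by
      have := Int.cast_le (R := ℝ).2 (one_le_slope_difference_sum_div hp hij' hjk' hk)
      simp only [hg]
      push_cast at this ⊢
      exact this
    have hn : 0 < (n : ℝ) := by linarith
    -- The bending term stays below `n ^ 3`, while a kink contributes at least `n ^ 3`.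
    have hb : ((j : ℝ) - i) * ((k : ℝ) - j) * ((k : ℝ) - i) < n * n * n := by
      gcongr <;> linarith
    nlinarith [pow_pos hn 3]
  · have ej : g j = g i + ((j : ℝ) - i) * ((i : ℕ) / p : ℕ) := by
      simp only [hg]
      rw [sum_div_eq_of_le hij'.le (hjk'.le.trans hk)]
      push_cast [hij'.le]
      ring
    have ek : g k = g i + ((k : ℝ) - i) * ((i : ℕ) / p : ℕ) := by
      simp only [hg]
      rw [sum_div_eq_of_le (hij'.trans hjk').le hk]
      push_cast [(hij'.trans hjk').le]
      ring
    have : 0 < ((j : ℝ) - i) * ((k : ℝ) - j) * ((k : ℝ) - i) :=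
      mul_pos (mul_pos (by linarith) (by linarith)) (by linarith)
    rw [ej, ek]
    linarith [this, show (n : ℝ) ^ 3 * (((j : ℝ) - i) * (g i + ((k : ℝ) - i) * ((i : ℕ) / p : ℕ) -
      (g i + ((j : ℝ) - i) * ((i : ℕ) / p : ℕ))) - ((k : ℝ) - j) * (g i + ((j : ℝ) - i) *
      ((i : ℕ) / p : ℕ) - g i)) = 0 by ring]

/-! ### Choice of the chain length -/

/-- A positive number below `P ^ m` cannot have `m` distinct prime factors above `P`, and Bertrand's
postulate gives one prime per doubling. -/
theorem exists_prime_not_dvd_of_lt_pow (m : ℕ) {d P : ℕ} (hd : 0 < d) (hP : 0 < P)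
    (h : d < P ^ m) : ∃ p, p.Prime ∧ P < p ∧ p ≤ 2 ^ m * P ∧ ¬ p ∣ d := by
  induction m generalizing d P with
  | zero => simp at h; omega
  | succ m ih =>
    obtain ⟨q, hq, hPq, hq2⟩ := Nat.exists_prime_lt_and_le_two_mul P hP.ne'
    have h2 : 2 ^ (m + 1) * P = 2 ^ m * (2 * P) := by ring
    by_cases hqd : q ∣ d
    · obtain ⟨e, rfl⟩ := hqd
      have he : 0 < e := Nat.pos_of_mul_pos_left hd
      have hlt : e < (2 * P) ^ m := by
        have h1 : P * e < P * P ^ m :=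
          calc P * e ≤ q * e := Nat.mul_le_mul_right _ hPq.le
            _ < P ^ (m + 1) := h
            _ = P * P ^ m := by ring
        exact (Nat.lt_of_mul_lt_mul_left h1).trans_le (Nat.pow_le_pow_left (by omega) _)
      obtain ⟨p, hp, hp1, hp2, hpe⟩ := ih he (by omega) hlt
      refine ⟨p, hp, by omega, h2 ▸ hp2, fun hdvd => ?_⟩
      rcases hp.dvd_mul.1 hdvd with hpq | hpe'
      · rw [Nat.prime_dvd_prime_iff_eq hp hq] at hpq
        omega
      · exact hpe hpe'
    · refine ⟨q, hq, hPq, hq2.trans ?_, hqd⟩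
      rw [h2]
      exact Nat.le_mul_of_pos_left _ (by positivity)

theorem exists_pow_four_le_and_le_pow {A : ℕ} (hA : 0 < A) :
    ∃ N, 0 < N ∧ ∀ n, N ≤ n → ∃ P, 0 < P ∧ (A * P) ^ 4 ≤ n ∧ n ^ 4 ≤ P ^ 17 := by
  -- This bound makes the greatest admissible `P` at least `(2 * A) ^ 16`, which absorbs the
  -- constant in `n ^ 4 ≤ (2 * A * P) ^ 16`.
  refine ⟨(A * (2 * A) ^ 16) ^ 4, by positivity, fun n hn => ?_⟩
  have hle : ∀ P, (A * P) ^ 4 ≤ n → P ≤ n := fun P h =>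
    (Nat.le_mul_of_pos_left P hA).trans ((Nat.le_self_pow (by norm_num) _).trans h)
  set P := Nat.findGreatest (fun P => (A * P) ^ 4 ≤ n) n with hP
  have hspec : (A * P) ^ 4 ≤ n :=
    Nat.findGreatest_spec (P := fun P => (A * P) ^ 4 ≤ n) (hle _ hn) hn
  have hlarge : (2 * A) ^ 16 ≤ P :=
    Nat.le_findGreatest (P := fun P => (A * P) ^ 4 ≤ n) (hle _ hn) hn
  have hpos : 0 < P := lt_of_lt_of_le (by positivity) hlarge
  refine ⟨P, hpos, hspec, ?_⟩
  have hlt : n < (A * (P + 1)) ^ 4 := by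
    by_contra! h
    have := Nat.le_findGreatest (P := fun P => (A * P) ^ 4 ≤ n) (hle _ h) h
    omega
  calc n ^ 4 ≤ ((A * (P + 1)) ^ 4) ^ 4 := Nat.pow_le_pow_left hlt.le _
    _ ≤ ((A * (2 * P)) ^ 4) ^ 4 := by gcongr; omega
    _ = (2 * A) ^ 16 * P ^ 16 := by ring
    _ ≤ P * P ^ 16 := Nat.mul_le_mul_right _ hlarge
    _ = P ^ 17 := by ring

/-- Cutting into chains of length `p` yields no edge with exactly `k` crossings, expressed through
the number of crossings of an edge between different chains and the bound for an edge inside a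
chain. -/
def ChainAvoids (n k p : ℕ) : Prop :=
  ∀ u v : ℕ, u < v → v < n →
    ((u / p + 1) * p < v → k + u % p * (p - u % p) +
      v % p * (min ((v / p + 1) * p) (n - 1) - v) ≠ (v - u - 1) * (n - 1 - (v - u))) ∧
    (v ≤ (u / p + 1) * p → (v - u - 1) * (p - (v - u)) < k)

theorem chainAvoids_half {n k : ℕ} (hn : 4 ≤ n) (hk : (n - 3) ^ 2 < 4 * k) :
    ChainAvoids n k (n / 2) := by
  intro u v huv hv
  obtain ⟨p, hp⟩ : ∃ p, n / 2 = p := ⟨_, rfl⟩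
  rw [hp]
  have hp0 : 0 < p := by omega
  obtain ⟨m, hm⟩ : ∃ m, n = p + m + 1 := ⟨n - 1 - p, by omega⟩
  refine ⟨fun h heq => ?_, fun _ => ?_⟩
  · have hup : u < p := by
      by_contra! hle
      have : 1 ≤ u / p := (Nat.le_div_iff_mul_le hp0).2 (by omega)
      have : 2 * p ≤ (u / p + 1) * p := Nat.mul_le_mul_right _ (by omega)
      omega
    rw [Nat.mod_eq_of_lt hup] at heq
    rw [Nat.div_eq_of_lt hup] at h
    have hvw : v % p * (min ((v / p + 1) * p) (n - 1) - v) = (v - p) * (n - 1 - v) := by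
      rcases Nat.lt_or_ge v (2 * p) with h2 | h2
      · have e : v / p = 1 := Nat.div_eq_of_lt_le (by omega) (by omega)
        rw [e, Nat.mod_eq_sub_mod (by omega), Nat.mod_eq_of_lt (by omega)]
        congr 2; omega
      -- For odd `n` the last vertex is itself a cut point.
      · obtain rfl : v = 2 * p := by omega
        rw [show n - 1 - 2 * p = 0 by omega]
        simp
    rw [hvw] at heq
    obtain ⟨s, hs⟩ : ∃ s, p = u + (s + 1) := ⟨p - u - 1, by omega⟩
    obtain ⟨t, ht⟩ : ∃ t, v = p + (t + 1) := ⟨v - p - 1, by omega⟩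
    obtain ⟨r, hr⟩ : ∃ r, m = (t + 1) + r := ⟨m - t - 1, by omega⟩
    rw [show p - u = s + 1 by omega, show v - p = t + 1 by omega, show n - 1 - v = r by omega,
      show v - u - 1 = s + t + 1 by omega, show n - 1 - (v - u) = u + r by omega] at heq
    rw [show n - 3 = (u + s) + (t + r) by omega] at hk
    -- The equation now says `k = s * r + t * u`, at most `(u + s) * (t + r)`, whose factors add up
    -- to `n - 3`.
    nlinarith [sq_nonneg ((u + s : ℤ) - (t + r)), mul_nonneg u.zero_le r.zero_le]
  · rcases Nat.lt_or_ge p (v - u) with h | h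
    · rw [Nat.sub_eq_zero_of_le h.le]
      omega
    · obtain ⟨x, hx⟩ : ∃ x, v - u = x + 1 := ⟨v - u - 1, by omega⟩
      obtain ⟨y, hy⟩ : ∃ y, p = x + 1 + y := ⟨p - (x + 1), by omega⟩
      rw [hx, hy, Nat.add_sub_cancel, Nat.add_sub_cancel_left]
      have h1 : (x + y) ^ 2 ≤ (n - 3) ^ 2 := Nat.pow_le_pow_left (by omega) _
      nlinarith [sq_nonneg ((x : ℤ) - y)]

theorem chainAvoids_one {n k : ℕ} (hk0 : 1 ≤ k)
    (hk : ∀ a b, a + b + 2 = n → a * b ≠ k) : ChainAvoids n k 1 := by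
  intro u v huv hv
  simp only [Nat.mod_one, zero_mul, add_zero, Nat.div_one, mul_one]
  refine ⟨fun _ h => hk _ _ (by omega) h.symm, fun h => ?_⟩
  rw [show v - u - 1 = 0 by omega]
  omega

/-- Here `W = (x - a) * (a + d - x)`, and two positive integers with sum `d` have product at least
`d - 1`. -/
theorem eq_zero_and_eq_or_eq_of_mul_add_eq_mul {a d x y W : ℕ}
    (h : a * (a + d) + W = x * y) (hxy : x + y = a + (a + d)) (hd : W + 1 < d) :
    W = 0 ∧ (x = a ∨ x = a + d) := by
  have e1 : (y : ℤ) = a + (a + d) - x := by omega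
  have e2 : (a : ℤ) * (a + d) + W = x * y := by exact_mod_cast h
  have e3 : ((x : ℤ) - a) * ((a + d) - x) = W := by
    rw [e1] at e2
    linear_combination -e2
  rcases Nat.eq_zero_or_pos W with hW0 | hW0
  · rw [hW0, Nat.cast_zero] at e3
    rcases mul_eq_zero.1 e3 with h | h <;> omega
  · have hWz : (0 : ℤ) < W := by exact_mod_cast hW0
    rcases pos_and_pos_or_neg_and_neg_of_mul_pos (e3 ▸ hWz) with ⟨h1, h2⟩ | ⟨h1, h2⟩
    · have := mul_nonneg (Int.sub_nonneg_of_le h1) (Int.sub_nonneg_of_le h2)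
      have hd' : (W : ℤ) + 1 < d := by exact_mod_cast hd
      linarith
    · omega

/-- From `(n - 2) ^ 2 = 4 * a * (a + d) + d ^ 2` it follows that `d ^ 2 ≥ 2 * n - 5`, which exceeds
`(q + 1) ^ 2` for `n ≥ 100`. -/
theorem add_one_lt_of_four_mul_le_sq {n a d q : ℕ} (hn : 100 ≤ n) (hab : a + (a + d) + 2 = n)
    (h4 : 4 * (a * (a + d)) ≤ (n - 3) ^ 2) (hqn : q ^ 2 ≤ n) : q + 1 < d := by
  obtain ⟨l, rfl⟩ : ∃ l, n = l + 3 := ⟨n - 3, by omega⟩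
  rw [Nat.add_sub_cancel] at h4
  by_contra! hlt
  have e : l + 1 = 2 * a + d := by omega
  have h1 : 2 * l + 1 ≤ d ^ 2 := by
    have : (l + 1) ^ 2 = 4 * (a * (a + d)) + d ^ 2 := by rw [e]; ring
    linarith
  have h2 : d ^ 2 ≤ (q + 1) ^ 2 := Nat.pow_le_pow_left hlt _
  nlinarith

theorem chainAvoids_of_not_dvd {n a b p : ℕ} (hn : 100 ≤ n) (hab : a + b + 2 = n) (ha : 1 ≤ a)
    (hle : a ≤ b) (h4 : 4 * (a * b) ≤ (n - 3) ^ 2) (hp0 : 0 < p) (hpn : p ^ 4 ≤ n)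
    (hp : ¬ p ∣ a * b * ((a + 1) * (b + 1))) : ChainAvoids n (a * b) p := by
  have hpa : ¬ p ∣ a := fun h => hp ((h.mul_right _).mul_right _)
  have hpb : ¬ p ∣ b := fun h => hp ((h.mul_left _).mul_right _)
  have hpa' : ¬ p ∣ a + 1 := fun h => hp ((h.mul_right _).mul_left _)
  have hpb' : ¬ p ∣ b + 1 := fun h => hp ((h.mul_left _).mul_left _)
  obtain ⟨q, hq⟩ : ∃ q, p ^ 2 = q := ⟨_, rfl⟩
  have hqn : q ^ 2 ≤ n := by rw [← hq]; convert hpn using 1; ring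
  obtain ⟨d, rfl⟩ := Nat.exists_eq_add_of_le hle
  have hd := add_one_lt_of_four_mul_le_sq hn hab h4 hqn
  intro u v huv hv
  refine ⟨fun h heq => ?_, fun _ => ?_⟩
  · obtain ⟨x, hx⟩ : ∃ x, v - u = x + 1 := ⟨v - u - 1, by omega⟩
    obtain ⟨y, hy⟩ : ∃ y, n - 1 - (v - u) = y := ⟨_, rfl⟩
    have hxy : x + y = a + (a + d) := by omega
    rw [hy, hx, Nat.add_sub_cancel] at heq
    have hmod : ∀ w, w % p < p := fun w => Nat.mod_lt _ hp0
    have hv1 := Nat.lt_div_add_one_mul v hp0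
    have hv2 : (v / p + 1) * p - v = p - v % p := by
      have := Nat.div_add_mod' v p
      rw [Nat.add_mul]
      omega
    have hW : ∀ w, w % p * (p - w % p) * 2 ≤ q := by
      intro w
      have hle : w % p * (p - w % p) * 2 ≤ (w % p + (p - w % p)) ^ 2 := by
        rw [add_sq]
        nlinarith
      rwa [Nat.add_sub_cancel' (hmod w).le, hq] at hle
    have hW1 := hW u
    have hW2 : v % p * (min ((v / p + 1) * p) (n - 1) - v) * 2 ≤ q := by
      have : min ((v / p + 1) * p) (n - 1) - v ≤ p - v % p := by omega
      exact (Nat.mul_le_mul_right 2 (Nat.mul_le_mul_left _ this)).trans (hW v)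
    rw [add_assoc] at heq
    obtain ⟨W, hWsum⟩ : ∃ W, u % p * (p - u % p) +
      v % p * (min ((v / p + 1) * p) (n - 1) - v) = W := ⟨_, rfl⟩
    rw [hWsum] at heq
    have hWq : W ≤ q := by omega
    obtain ⟨hW0, hxcase⟩ := eq_zero_and_eq_or_eq_of_mul_add_eq_mul heq hxy (by omega)
    rw [hW0] at hWsum
    obtain ⟨hu0, hv0⟩ := Nat.add_eq_zero_iff.1 hWsum
    have hpu : p ∣ u := by
      rcases Nat.mul_eq_zero.1 hu0 with h | h
      · exact Nat.dvd_of_mod_eq_zero h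
      · have := hmod u; omega
    -- Either `v` is also a multiple of `p`, so that `p` divides `v - u = x + 1`, or `v = n - 1`, so
    -- that `u = y` is `a` or `a + d`.
    rcases Nat.mul_eq_zero.1 hv0 with h | h
    · have hpx : p ∣ x + 1 := hx ▸ Nat.dvd_sub (Nat.dvd_of_mod_eq_zero h) hpu
      rcases hxcase with rfl | rfl
      · exact hpa' hpx
      · exact hpb' hpx
    · rcases hxcase with rfl | rfl
      · exact hpb ((show u = x + d by omega) ▸ hpu)
      · exact hpa ((show u = a by omega) ▸ hpu)
  · have h1 : (v - u - 1) * (p - (v - u)) ≤ q := by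
      rw [← hq, pow_two]
      rcases Nat.lt_or_ge p (v - u) with h | h
      · rw [Nat.sub_eq_zero_of_le h.le]; simp
      · exact Nat.mul_le_mul (by omega) (by omega)
    have h2 : a + d ≤ a * (a + d) := Nat.le_mul_of_pos_left _ ha
    omega

theorem exists_chainAvoids : ∃ N, 0 < N ∧ ∀ k, 1 ≤ k → ∀ n, N ≤ n →
    ∃ p, 0 < p ∧ ChainAvoids n k p := by
  obtain ⟨N, hN, h⟩ := exists_pow_four_le_and_le_pow (A := 2 ^ 17) (by norm_num)
  refine ⟨max N 100, by omega, fun k hk n hn => ?_⟩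
  rcases Nat.lt_or_ge ((n - 3) ^ 2) (4 * k) with hbig | hsmall
  · exact ⟨n / 2, by omega, chainAvoids_half (by omega) hbig⟩
  by_cases hprod : ∀ a b, a + b + 2 = n → a * b ≠ k
  · exact ⟨1, one_pos, chainAvoids_one hk hprod⟩
  push Not at hprod
  have main : ∀ a b, a ≤ b → a + b + 2 = n → a * b = k → ∃ p, 0 < p ∧ ChainAvoids n k p := by
    rintro a b hab hsum rfl
    have ha : 1 ≤ a := Nat.pos_of_mul_pos_right hk
    have hn100 : 100 ≤ n := by omega
    have hlt : a * b * ((a + 1) * (b + 1)) < n ^ 4 :=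
      calc a * b * ((a + 1) * (b + 1)) < n * n * (n * n) :=
            Nat.mul_lt_mul'' (Nat.mul_lt_mul'' (by omega) (by omega))
              (Nat.mul_lt_mul'' (by omega) (by omega))
        _ = n ^ 4 := by ring
    obtain ⟨P, hP, hPn, hnP⟩ := h n (by omega)
    -- The exponent `17` exceeds `16`: the product is below `n ^ 4`, which is about `P ^ 16` up to a
    -- constant.
    obtain ⟨p, hp, -, hple, hpd⟩ := exists_prime_not_dvd_of_lt_pow 17
      (Nat.mul_pos hk (by positivity)) hP (hlt.trans_le hnP)
    exact ⟨p, hp.pos, chainAvoids_of_not_dvd hn100 hsum ha hab hsmall hp.pos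
      ((Nat.pow_le_pow_left hple 4).trans hPn) hpd⟩
  obtain ⟨a, b, hsum, hab⟩ := hprod
  rcases Nat.le_total a b with hle | hle
  · exact main a b hle hsum hab
  · exact main b a hle (by omega) (by rw [mul_comm, hab])

theorem mainTheorem4 :
    ∃ N : ℕ, 0 < N ∧ ∀ k : ℕ, 1 ≤ k → ∀ n : ℕ, N ≤ n →
      IsLeast
        (Set.range fun D : RectilinearDrawing (⊤ : SimpleGraph (Fin n)) => D.crossingIndex k) 0 := by
  obtain ⟨N, -, h⟩ := exists_chainAvoids
  refine ⟨N + 3, by omega, fun k hk n hn => ⟨?_, fun _ _ => Nat.zero_le _⟩⟩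
  obtain ⟨p, hp, havoid⟩ := h k hk n (by omega)
  have hchain := hasChainOrientation_chainPoints n hp
  obtain ⟨D, hD⟩ := exists_drawing_sameOrientation (by omega) hchain.inGeneralPosition
  have hDchain := hchain.congr hD
  have hlt : ∀ u v : Fin n, u < v → (D.crossingsOn s(u, v)).encard ≠ k := by
    intro u v huv heq
    rw [D.encard_crossingsOn hDchain.inGeneralPosition huv.ne,
      ← (Set.toFinite _).cast_ncard_eq] at heq
    have hc : (crossingPairs D.pos u v).ncard = k := by exact_mod_cast heq
    obtain ⟨h1, h2⟩ := havoid u v huv v.isLt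
    rcases Nat.lt_or_ge (((u : ℕ) / p + 1) * p) v with hd | hs
    · exact h1 hd (hc ▸ hDchain.card_crossingPairs hp hd)
    · exact ((hDchain.card_crossingPairs_le huv hs).trans_lt (h2 hs)).ne hc
  refine ⟨D, ?_⟩
  have hempty : D.crossingSet k = ∅ := by
    refine Set.eq_empty_of_forall_notMem fun e ⟨he, hek⟩ => ?_
    induction e using Sym2.ind with | _ u v
    rcases lt_or_gt_of_ne (show u ≠ v from he) with huv | huv
    · exact hlt u v huv hek
    · exact hlt v u huv (Sym2.eq_swap (a := u) (b := v) ▸ hek)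
  simp [RectilinearDrawing.crossingIndex, hempty]
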